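/- Let $A,B$ be complex $D\times D$ matrices with $A=A^\dagger$, $B=B^T$, and put $$\mathsf S=\begin{pmatrix}A&B\\B^*&A^*\end{pmatrix},\qquad \mathsf N=\begin{pmatrix}1&0\\0&-1\end{pmatrix},$$ where $^*$ is the entrywise complex conjugate. A complete set of Jordan basis vectors of a $2D\times 2D$ matrix $M$ is a basis $\{\xi^{(\nu)}_k : \nu\in I,\ 1\le k\le d_\nu\}$ of $\mathbb C^{2D}$, with $d_\nu\ge 1$, for which there are $\omega_\nu\in\mathbb C$ and $c^{(\nu)}_k\in\mathbb C\setminus\{0\}$ ($1\le k<d_\nu$) such that $$M\xi^{(\nu)}_1=\omega_\nu\,\xi^{(\nu)}_1,\qquad M\xi^{(\nu)}_{k+1}=\omega_\nu\,\xi^{(\nu)}_{k+1}+i\,c^{(\nu)}_k\,\xi^{(\nu)}_k\quad(1\le k<d_\nu).$$ The vectors with a fixed $\nu$ form one Jordan block, of dimension $d_\nu$ and eigenvalue $\omega_\nu$. If the $\xi^{(\nu)}_k$ are such a set for $\mathsf{NS}$, then the $\mathsf N\xi^{(\nu)}_k$ are such a set for $\mathsf{SN}$, with the same data $(d_\nu,\omega_\nu,c^{(\nu)}_k)$.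 The overlap of two vectors $x,y$ is $x^\dagger y$. **Proposition.** The matrix $\mathsf{NS}$ has a complete set of Jordan basis vectors. Moreover, every complete set of Jordan basis vectors of $\mathsf{NS}$ can be transformed into a complete set $\{\xi^{(\nu)}_k\}$ of Jordan basis vectors of $\mathsf{NS}$, with the same blocks and the same $d_\nu,\omega_\nu,c^{(\nu)}_k$, such that each $\xi^{(\nu)}_k$ has non-vanishing overlap with exactly one of the corresponding basis vectors $\mathsf N\xi^{(\nu')}_{k'}$ of $\mathsf{SN}$. The resulting correspondence between the basis vectors of $\mathsf{NS}$ and those of $\mathsf{SN}$ is one-to-one, and it induces a one-to-one correspondence $\nu\mapsto\sigma(\nu)$ between the Jordan blocks of $\mathsf{NS}$ and those of $\mathsf{SN}$. Corresponding blocks have equal dimensions and complex conjugate eigenvalues, $d_{\sigma(\nu)}=d_\nu$ and $\omega_{\sigma(\nu)}=\omega_\nu^*$, and the order inside the blocks is reversed: $$\xi^{(\nu)\dagger}_k\,\mathsf N\,\xi^{(\nu')}_{k'}\neq 0\iff \nu'=\sigma(\nu)\ \text{ and }\ k'=d_\nu+1-k .$$ -/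

import Mathlib

open scoped Matrix

namespace RPA

/-- The stability matrix with blocks `A`, `B`, `B*`, `A*` (entrywise complex conjugates). -/
def stab {n : Type*} (A B : Matrix n n ℂ) : Matrix (n ⊕ n) (n ⊕ n) ℂ :=
  Matrix.fromBlocks A B (B.map star) (A.map star)

/-- The indefinite metric `diag(1, -1)`. -/
def metric (n : Type*) [DecidableEq n] : Matrix (n ⊕ n) (n ⊕ n) ℂ :=
  Matrix.fromBlocks 1 0 0 (-1)

/-- The overlap `x† y` of two complex column vectors. -/
def overlap {m : Type*} [Fintype m] (x y : m → ℂ) : ℂ := star x ⬝ᵥ y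

/-- `ξ` is a complete set of Jordan basis vectors of the matrix `M`.
The blocks are labelled by `ν : ι`; the block `ν` has dimension `d ν`, eigenvalue `ω ν` and nonzero
chain constants `i c`. Positions in a block are counted from `0`, so `ξ ⟨ν, k⟩` is the
`(k + 1)`-st vector of the chain; the value `c ν k` is relevant only for `k + 1 < d ν`. -/
structure IsJordanBasis {m ι : Type*} [Fintype m] (M : Matrix m m ℂ)
    (d : ι → ℕ) (ω : ι → ℂ) (c : ι → ℕ → ℂ)
    (ξ : Module.Basis ((ν : ι) × Fin (d ν)) ℂ (m → ℂ)) : Prop where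
  dim_pos : ∀ ν, 0 < d ν
  const_ne_zero : ∀ ν k, k + 1 < d ν → c ν k ≠ 0
  eigenvector : ∀ (ν : ι) (h : 0 < d ν), M *ᵥ ξ ⟨ν, ⟨0, h⟩⟩ = ω ν • ξ ⟨ν, ⟨0, h⟩⟩
  chain : ∀ (ν : ι) (k : ℕ) (h : k + 1 < d ν),
    M *ᵥ ξ ⟨ν, ⟨k + 1, h⟩⟩ =
      ω ν • ξ ⟨ν, ⟨k + 1, h⟩⟩ +
        (Complex.I * c ν k) • ξ ⟨ν, ⟨k, (Nat.lt_succ_self k).trans h⟩⟩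

end RPA

/-!
The matrix `M = N S` is selfadjoint for the indefinite Hermitian form `h x y = x† N y`, which is
nondegenerate because `N² = 1`, and `h` is exactly the overlap of `x` with the vector `N y` of the
dual system. What is needed is therefore the canonical form of an operator `M` that is selfadjoint
for a nondegenerate Hermitian form (`exists_isSipSystem_span_eq_top`): there is a Jordan basis in
which every block pairs, antidiagonally, with exactly one block of the same dimension and the
conjugate eigenvalue.

The canonical form is built by splitting off blocks. Take an eigenvalue `μ` and a vector `x` of
maximal height `m + 1` in its generalized eigenspace. As `h` is nondegenerate, the eigenvector
`(M - μ)^m x` pairs non-trivially with some generalized eigenvector `y`, whose eigenvalue must be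
the conjugate of `μ`. If `μ` is real, polarization allows `x = y`, and a real polynomial in `M - μ`
applied to `x` kills all pairings `h ((M - μ)^i x) x` with `i < m` (`exists_sip_single`). If `μ` is
not real, the same is achieved by a polynomial applied to `y` alone (`exists_sip_pair`); each of the
two chains is then isotropic, because generalized eigenspaces whose eigenvalues are not conjugate
are orthogonal (`maxGenEigenspace_orthogonal`). The span of the block, or pair of blocks, is
nondegenerate, so the space is its direct sum with its orthogonal complement, to which induction on
the dimension applies. Linear independence is automatic from the Gram matrix. The existence of a
Jordan basis comes out as well.

A given Jordan basis of `M` has the same blocks as the canonical one up to relabelling, since the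
number of blocks with eigenvalue `μ` and dimension greater than `k` is the dimension of
`ker (M - μ) ⊓ range (M - μ)^k` (`IsJordanBasis.exists_equiv`). The chain constants can be
prescribed at will by rescaling basis vectors (`IsSipSystem.exists_isJordanBasis`), and rescaling
does not change which overlaps vanish.
-/

namespace RPA

/-! ### Splitting off blocks from an operator selfadjoint for a Hermitian form -/

section SipSystem

open scoped ComplexConjugate

variable {V : Type*} [AddCommGroup V] [Module ℂ V]

/-- Generators of Jordan chains of `M` whose Gram matrix for the sesquilinear form `h` is in sip form
(standard involutory permutation, up to scaling of the entries). The block `ν` is generated by `x ν`, has eigenvalue `ω ν`, and consists of the vectors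
`(M - ω ν) ^ a (x ν)` with `a < d ν`, so that `a` counts positions from the *top* of the chain.
A vector of the block `ν` pairs non-trivially under `h` with exactly one vector of the whole system,
which lies in the block `σ ν` at the mirrored position (the Gram matrix of paired blocks is
antidiagonal). -/
structure IsSipSystem {ι : Type*} (M : Module.End ℂ V) (h : V →ₗ⋆[ℂ] V →ₗ[ℂ] ℂ)
    (d : ι → ℕ) (ω : ι → ℂ) (σ : Equiv.Perm ι) (x : ι → V) : Prop where
  dim_pos : ∀ ν, 0 < d ν
  pow_apply : ∀ ν, ((M - ω ν • 1) ^ d ν) (x ν) = 0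
  gram : ∀ ν ν' a b, a < d ν → b < d ν' →
    (h (((M - ω ν • 1) ^ a) (x ν)) (((M - ω ν' • 1) ^ b) (x ν')) ≠ 0 ↔
      ν' = σ ν ∧ a + b + 1 = d ν)
  dim_perm : ∀ ν, d (σ ν) = d ν
  eigenvalue_perm : ∀ ν, ω (σ ν) = conj (ω ν)

/-- The vectors of the chains generated by `x`, positions being counted from the top. -/
def chainVec {ι : Type*} (M : Module.End ℂ V) (d : ι → ℕ) (ω : ι → ℂ) (x : ι → V)
    (p : (ν : ι) × Fin (d ν)) : V :=
  ((M - ω p.1 • 1) ^ (p.2 : ℕ)) (x p.1)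

/-- The correspondence of basis vectors induced by a dimension-preserving correspondence `σ` of
blocks: the order inside each block is reversed. -/
def mirror {ι : Type*} {d : ι → ℕ} (σ : Equiv.Perm ι) (hd : ∀ ν, d (σ ν) = d ν) :
    Equiv.Perm ((ν : ι) × Fin (d ν)) :=
  Equiv.sigmaCongr σ fun ν => Fin.revPerm.trans (finCongr (hd ν).symm)

theorem eq_mirror_iff {ι : Type*} {d : ι → ℕ} (σ : Equiv.Perm ι) (hd : ∀ ν, d (σ ν) = d ν)
    (p q : (ν : ι) × Fin (d ν)) :
    q = mirror σ hd p ↔ q.1 = σ p.1 ∧ (q.2 : ℕ) + p.2 + 1 = d p.1 := by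
  obtain ⟨ν, k⟩ := p
  obtain ⟨ν', l⟩ := q
  have h1 : mirror σ hd ⟨ν, k⟩ = ⟨σ ν, finCongr (hd ν).symm (Fin.rev k)⟩ := rfl
  rw [h1]
  constructor
  · intro h
    obtain ⟨rfl, h⟩ := Sigma.mk.inj_iff.1 h
    rw [eq_of_heq h]
    refine ⟨rfl, ?_⟩
    simp only [finCongr_apply, Fin.val_cast, Fin.val_rev]
    omega
  · rintro ⟨h, h'⟩
    dsimp only at h h'
    subst h
    congr 1
    ext
    simp only [finCongr_apply, Fin.val_cast, Fin.val_rev]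
    omega

variable {M : Module.End ℂ V} {h : V →ₗ⋆[ℂ] V →ₗ[ℂ] ℂ}

theorem sub_smul_adjoint (hM : ∀ x y, h (M x) y = h x (M y)) (μ : ℂ) (x y : V) :
    h ((M - μ • 1) x) y = h x ((M - conj μ • 1) y) := by
  simp [hM]

theorem pow_adjoint {K L : Module.End ℂ V} (hKL : ∀ x y, h (K x) y = h x (L y)) (k : ℕ) (x y : V) :
    h ((K ^ k) x) y = h x ((L ^ k) y) := by
  induction k generalizing x with
  | zero => simp
  | succ k ih => rw [pow_succ, Module.End.mul_apply, ih, hKL, pow_succ', Module.End.mul_apply]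

theorem pow_apply_eq_zero_of_le {K : Module.End ℂ V} {m n : ℕ} {x : V} (hx : (K ^ m) x = 0)
    (hmn : m ≤ n) : (K ^ n) x = 0 := by
  obtain ⟨k, rfl⟩ := Nat.exists_eq_add_of_le' hmn
  rw [pow_add, Module.End.mul_apply, hx, map_zero]

theorem pow_apply_pow_apply {K : Module.End ℂ V} (m n : ℕ) (x : V) :
    (K ^ m) ((K ^ n) x) = (K ^ (m + n)) x := by
  rw [pow_add, Module.End.mul_apply]

/-- Correcting `y` by multiples of the vectors `L ^ j y` makes all pairings of the chain of `x` with
`y` vanish, except the one with the bottom vector of the chain. -/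
theorem exists_sip_pair {K L : Module.End ℂ V} (hKL : ∀ x y, h (K x) y = h x (L y))
    {m : ℕ} {x y : V} (hx : (K ^ (m + 1)) x = 0) (hxy : h ((K ^ m) x) y ≠ 0) {S : Submodule ℂ V}
    (hS : ∀ z ∈ S, L z ∈ S) (hy : y ∈ S) :
    ∃ y' ∈ S, ∀ i, h ((K ^ i) x) y' ≠ 0 ↔ i = m := by
  have hSp : ∀ k, ∀ z ∈ S, (L ^ k) z ∈ S := by
    intro k
    induction k with
    | zero => simp
    | succ k ih => intro z hz; rw [pow_succ', Module.End.mul_apply]; exact hS _ (ih z hz)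
  -- the pairings with the indices `m - j ≤ i < m` are removed one after the other
  have key : ∀ j, j ≤ m → ∃ y' ∈ S, h ((K ^ m) x) y' ≠ 0 ∧
      ∀ i, m - j ≤ i → i < m → h ((K ^ i) x) y' = 0 := by
    intro j
    induction j with
    | zero => intro _; exact ⟨y, hy, hxy, fun i h1 h2 => by omega⟩
    | succ j ih =>
      intro hj
      obtain ⟨y', hyS, hy0, hyi⟩ := ih (by omega)
      have hexp : ∀ (i : ℕ) (t : ℂ), h ((K ^ i) x) (y' + t • (L ^ (j + 1)) y') =
          h ((K ^ i) x) y' + t * h ((K ^ (i + (j + 1))) x) y' := by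
        intro i t
        rw [map_add, map_smul, ← pow_adjoint hKL, pow_apply_pow_apply, smul_eq_mul,
          add_comm (j + 1) i]
      refine ⟨y' + (-(h ((K ^ (m - (j + 1))) x) y' / h ((K ^ m) x) y')) • (L ^ (j + 1)) y',
        S.add_mem hyS (S.smul_mem _ (hSp _ _ hyS)), ?_, ?_⟩
      · rw [hexp, pow_apply_eq_zero_of_le hx (n := m + (j + 1)) (by omega)]
        simpa using hy0
      · intro i h1 h2
        rw [hexp]
        rcases eq_or_lt_of_le h1 with rfl | h1
        · rw [show m - (j + 1) + (j + 1) = m by omega]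
          field_simp
          ring
        · rw [pow_apply_eq_zero_of_le hx (n := i + (j + 1)) (by omega), hyi i (by omega) h2]
          simp
  obtain ⟨y', hyS, hy0, hyi⟩ := key m le_rfl
  refine ⟨y', hyS, fun i => ⟨fun hi => ?_, fun hi => hi ▸ hy0⟩⟩
  by_contra hne
  rcases lt_or_gt_of_ne hne with h1 | h1
  · exact hi (hyi i (by omega) h1)
  · exact hi (by rw [pow_apply_eq_zero_of_le hx (by omega)]; simp)

/-- The selfadjoint counterpart of `exists_sip_pair`: here both entries of the pairing are changed
at once, so the corrections have to be real multiples of half the size. -/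
theorem exists_sip_single (hsymm : ∀ x y, conj (h x y) = h y x) {K : Module.End ℂ V}
    (hK : ∀ x y, h (K x) y = h x (K y)) {m : ℕ} {x : V} (hx : (K ^ (m + 1)) x = 0)
    (hxx : h ((K ^ m) x) x ≠ 0) :
    ∃ x', (K ^ (m + 1)) x' = 0 ∧ ∀ i, h ((K ^ i) x') x' ≠ 0 ↔ i = m := by
  have key : ∀ j, j ≤ m → ∃ x', (K ^ (m + 1)) x' = 0 ∧ h ((K ^ m) x') x' ≠ 0 ∧
      ∀ i, m - j ≤ i → i < m → h ((K ^ i) x') x' = 0 := by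
    intro j
    induction j with
    | zero => intro _; exact ⟨x, hx, hxx, fun i h1 h2 => by omega⟩
    | succ j ih =>
      intro hj
      obtain ⟨y, hy, hy0, hyi⟩ := ih (by omega)
      have hreal : ∀ i, conj (h ((K ^ i) y) y) = h ((K ^ i) y) y := fun i => by
        rw [hsymm, pow_adjoint hK]
      have hexp : ∀ (i : ℕ) (t : ℂ), conj t = t →
          h ((K ^ i) (y + t • (K ^ (j + 1)) y)) (y + t • (K ^ (j + 1)) y) =
          h ((K ^ i) y) y + 2 * t * h ((K ^ (i + (j + 1))) y) y +
            t ^ 2 * h ((K ^ (i + (j + 1) + (j + 1))) y) y := by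
        intro i t ht
        simp only [map_add, map_smul, map_smulₛₗ, LinearMap.add_apply, LinearMap.smul_apply,
          smul_eq_mul, ← pow_adjoint hK, pow_apply_pow_apply, ht, add_comm (j + 1), ← add_assoc]
        ring
      set t : ℂ := -(h ((K ^ (m - (j + 1))) y) y / (2 * h ((K ^ m) y) y)) with ht
      have htr : conj t = t := by simp [ht, hreal, map_ofNat]
      refine ⟨y + t • (K ^ (j + 1)) y, ?_, ?_, ?_⟩
      · rw [map_add, map_smul, pow_apply_pow_apply, hy, pow_apply_eq_zero_of_le hy (by omega)]
        simp
      · rw [hexp _ _ htr, pow_apply_eq_zero_of_le hy (n := m + (j + 1)) (by omega),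
          pow_apply_eq_zero_of_le hy (n := m + (j + 1) + (j + 1)) (by omega)]
        simpa using hy0
      · intro i h1 h2
        rw [hexp _ _ htr, pow_apply_eq_zero_of_le hy (n := i + (j + 1) + (j + 1)) (by omega)]
        rcases eq_or_lt_of_le h1 with rfl | h1
        · rw [show m - (j + 1) + (j + 1) = m by omega, ht]
          simp only [map_zero, LinearMap.zero_apply]
          field_simp
          ring
        · rw [pow_apply_eq_zero_of_le hy (n := i + (j + 1)) (by omega), hyi i (by omega) h2]
          simp
  obtain ⟨y, hy, hy0, hyi⟩ := key m le_rfl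
  refine ⟨y, hy, fun i => ⟨fun hi => ?_, fun hi => hi ▸ hy0⟩⟩
  by_contra hne
  rcases lt_or_gt_of_ne hne with h1 | h1
  · exact hi (hyi i (by omega) h1)
  · exact hi (by rw [pow_apply_eq_zero_of_le hy (by omega)]; simp)

/-- Generalized eigenspaces are `h`-orthogonal unless their eigenvalues are conjugate: on the first
one, `M - conj μ` is invertible, and its adjoint `M - μ` is nilpotent on the second one. -/
theorem maxGenEigenspace_orthogonal [FiniteDimensional ℂ V] (hM : ∀ x y, h (M x) y = h x (M y))
    {lam μ : ℂ} (hne : lam ≠ conj μ) {x y : V} (hx : x ∈ M.maxGenEigenspace lam)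
    (hy : y ∈ M.maxGenEigenspace μ) : h x y = 0 := by
  obtain ⟨k, hk⟩ := (Module.End.mem_maxGenEigenspace _ _ _).1 hy
  set K := (M - conj μ • (1 : Module.End ℂ V)) with hKdef
  have hmaps : Set.MapsTo K (M.maxGenEigenspace lam) (M.maxGenEigenspace lam) :=
    Module.End.mapsTo_maxGenEigenspace_of_comm
      ((Commute.refl M).sub_right ((Commute.one_right M).smul_right _)) lam
  have hker : ∀ z ∈ M.maxGenEigenspace lam, K z = 0 → z = 0 := by
    intro z hz hz0
    have h1 : z ∈ M.maxGenEigenspace (conj μ) :=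
      (Module.End.mem_maxGenEigenspace _ _ _).2 ⟨1, by rwa [pow_one]⟩
    exact (Submodule.disjoint_def.1 (Module.End.disjoint_genEigenspace M hne ⊤ ⊤)) z hz h1
  have hsurj : Function.Surjective (K.restrict hmaps) := by
    apply LinearMap.surjective_of_injective
    rw [← LinearMap.ker_eq_bot, LinearMap.ker_eq_bot']
    intro z hz
    exact Subtype.ext (hker z z.2 (congrArg Subtype.val hz))
  have hpow : ∀ k, ∀ x ∈ M.maxGenEigenspace lam, ∃ z, (K ^ k) z = x := by
    intro k
    induction k with
    | zero => intro x _; exact ⟨x, by simp⟩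
    | succ k ih =>
      intro x hx
      obtain ⟨w, hw⟩ := hsurj ⟨x, hx⟩
      obtain ⟨z, hz⟩ := ih w w.2
      refine ⟨z, ?_⟩
      rw [pow_succ', Module.End.mul_apply, hz]
      exact congrArg Subtype.val hw
  obtain ⟨z, rfl⟩ := hpow k x hx
  have hadj := sub_smul_adjoint hM (conj μ)
  rw [Complex.conj_conj] at hadj
  rw [pow_adjoint hadj, hk, map_zero]

theorem exists_mem_maxGenEigenspace_of_ne_zero [FiniteDimensional ℂ V] {f : V →ₗ[ℂ] ℂ}
    (hf : f ≠ 0) (M : Module.End ℂ V) : ∃ μ, ∃ y ∈ M.maxGenEigenspace μ, f y ≠ 0 := by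
  by_contra! hcon
  apply hf
  rw [← LinearMap.ker_eq_top, eq_top_iff, ← Module.End.iSup_maxGenEigenspace_eq_top M]
  exact iSup_le fun μ y hy => hcon μ y hy

/-- A block (for a real eigenvalue) or a pair of blocks (for a pair of conjugate eigenvalues) in
sip form. It is generated by a vector `x` of maximal height in a generalized eigenspace, together
with a vector `y` that pairs with the bottom vector of the chain of `x`. -/
theorem exists_isSipSystem_of_nontrivial [FiniteDimensional ℂ V] [Nontrivial V]
    (hsymm : ∀ x y, conj (h x y) = h y x) (hnd : ∀ x, (∀ y, h x y = 0) → x = 0)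
    (hM : ∀ x y, h (M x) y = h x (M y)) :
    ∃ (ι : Type) (_ : Finite ι) (_ : Nonempty ι) (d : ι → ℕ) (ω : ι → ℂ) (σ : Equiv.Perm ι)
      (x : ι → V), IsSipSystem M h d ω σ x := by
  obtain ⟨μ, hμ⟩ := Module.End.exists_eigenvalue M
  obtain ⟨v, hv⟩ := hμ.exists_hasEigenvector
  set K := (M - μ • (1 : Module.End ℂ V)) with hKdef
  set L := (M - conj μ • (1 : Module.End ℂ V)) with hLdef
  have hKL : ∀ x y, h (K x) y = h x (L y) := sub_smul_adjoint hM μ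
  have hKmem : ∀ z, z ∈ M.maxGenEigenspace μ ↔ ∃ k, (K ^ k) z = 0 :=
    Module.End.mem_maxGenEigenspace _ _
  have hLmem : ∀ z, z ∈ M.maxGenEigenspace (conj μ) ↔ ∃ k, (L ^ k) z = 0 :=
    Module.End.mem_maxGenEigenspace _ _
  -- the maximal height `m + 1` of a chain for the eigenvalue `μ`
  have hex : ∃ k, ∀ z ∈ M.maxGenEigenspace μ, (K ^ k) z = 0 := by
    refine ⟨M.maxGenEigenspaceIndex μ, fun z hz => ?_⟩
    rw [Module.End.maxGenEigenspace_eq, Module.End.mem_genEigenspace_nat] at hz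
    exact hz
  classical
  obtain ⟨m, hm⟩ : ∃ m, Nat.find hex = m + 1 := by
    refine Nat.exists_eq_succ_of_ne_zero fun h0 => ?_
    have h1 := Nat.find_spec hex v ((hKmem v).2 ⟨1, by
      simpa [hKdef, sub_eq_zero] using hv.apply_eq_smul⟩)
    rw [h0] at h1
    exact hv.2 (by simpa using h1)
  have hspec : ∀ z ∈ M.maxGenEigenspace μ, (K ^ (m + 1)) z = 0 := hm ▸ Nat.find_spec hex
  obtain ⟨x, hx, hx0⟩ : ∃ x ∈ M.maxGenEigenspace μ, (K ^ m) x ≠ 0 := by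
    have := Nat.find_min hex (m := m) (by omega)
    push Not at this
    exact this
  obtain ⟨lam, y, hy, hxy⟩ := exists_mem_maxGenEigenspace_of_ne_zero
    (f := h ((K ^ m) x)) (fun h0 => hx0 (hnd _ fun y => by rw [h0]; rfl)) M
  have hmaps : ∀ k, ∀ z ∈ M.maxGenEigenspace μ, (K ^ k) z ∈ M.maxGenEigenspace μ := by
    intro k z hz
    obtain ⟨l, hl⟩ := (hKmem z).1 hz
    exact (hKmem _).2 ⟨l, by rw [pow_apply_pow_apply, pow_apply_eq_zero_of_le hl (by omega)]⟩
  have hLmaps : ∀ k, ∀ z ∈ M.maxGenEigenspace (conj μ),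
      (L ^ k) z ∈ M.maxGenEigenspace (conj μ) := by
    intro k z hz
    obtain ⟨l, hl⟩ := (hLmem z).1 hz
    exact (hLmem _).2 ⟨l, by rw [pow_apply_pow_apply, pow_apply_eq_zero_of_le hl (by omega)]⟩
  have hlam : lam = conj μ := by
    by_contra hne
    refine hxy (maxGenEigenspace_orthogonal hM (fun h' => hne ?_) (hmaps m x hx) hy)
    rw [h', Complex.conj_conj]
  subst hlam
  by_cases hμr : conj μ = μ
  · have hLK : L = K := by rw [hLdef, hμr]
    rw [hLK] at hKL
    rw [hμr] at hy
    -- polarization turns the pair `x`, `y` into a single vector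
    obtain ⟨z, hz, hzz⟩ : ∃ z ∈ M.maxGenEigenspace μ, h ((K ^ m) z) z ≠ 0 := by
      by_contra! hcon
      have h1 := hcon _ (Submodule.add_mem _ hx hy)
      have h2 := hcon _ (Submodule.add_mem _ hx (Submodule.smul_mem _ Complex.I hy))
      simp only [map_add, map_smul, map_smulₛₗ, LinearMap.add_apply, LinearMap.smul_apply,
        hcon x hx, hcon y hy, smul_eq_mul, Complex.conj_I] at h1 h2
      apply hxy
      linear_combination h1 / 2 - Complex.I / 2 * h2 + (h ((K ^ m) x) y / 2 -
        h ((K ^ m) y) x / 2) * Complex.I_sq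
    obtain ⟨x', hx', hg⟩ := exists_sip_single hsymm hKL (hspec z hz) hzz
    refine ⟨Unit, inferInstance, inferInstance, fun _ => m + 1, fun _ => μ, 1, fun _ => x',
      fun _ => Nat.succ_pos m, fun _ => hx', fun _ _ a b _ _ => ?_, fun _ => rfl,
      fun _ => hμr.symm⟩
    rw [← pow_adjoint hKL, pow_apply_pow_apply, hg]
    simp [add_comm]
  · obtain ⟨y', hy', hg⟩ := exists_sip_pair hKL (hspec x hx) hxy
      (S := M.maxGenEigenspace (conj μ)) (fun z hz => by simpa using hLmaps 1 z hz) hy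
    have hy0 : (L ^ (m + 1)) y' = 0 := by
      refine hnd _ fun z => ?_
      rw [← hsymm, map_eq_zero]
      by_contra hz
      obtain ⟨lam, w, hw, hw0⟩ := exists_mem_maxGenEigenspace_of_ne_zero
        (f := h ((L ^ (m + 1)) y')) (fun h0 => hz (by rw [← hsymm, h0]; simp)) M
      by_cases hl : lam = μ
      · subst hl
        apply hw0
        rw [← hsymm, ← pow_adjoint hKL, hspec w hw]
        simp
      · refine hw0 (maxGenEigenspace_orthogonal hM (fun h' => hl ?_) (hLmaps _ _ hy') hw)
        simpa using (congrArg conj h').symm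
    have hg' : ∀ a b, h ((K ^ a) x) ((L ^ b) y') ≠ 0 ↔ a + b + 1 = m + 1 := fun a b => by
      rw [← pow_adjoint hKL, pow_apply_pow_apply, hg]
      omega
    refine ⟨Bool, inferInstance, inferInstance, fun _ => m + 1, fun b => cond b (conj μ) μ,
      Equiv.boolNot, fun b => cond b y' x, fun _ => Nat.succ_pos m, ?_, ?_, fun _ => rfl, ?_⟩
    · rintro (_ | _)
      · exact hspec x hx
      · exact hy0
    · rintro (_ | _) (_ | _) a b _ _
      · simpa using maxGenEigenspace_orthogonal hM (Ne.symm hμr) (hmaps a x hx) (hmaps b x hx)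
      · simpa using hg' a b
      · have := hg' b a
        rw [← hsymm, Ne, map_eq_zero] at this
        simpa [add_comm b a, hsymm] using this
      · refine iff_of_false (not_not.2 (maxGenEigenspace_orthogonal hM (fun h' => hμr ?_)
          (hLmaps a y' hy') (hLmaps b y' hy'))) (by simp)
        simpa using h'
    · rintro (_ | _) <;> simp

end SipSystem

/-! ### Canonical form by induction on orthogonal complements -/

section Splitting

open scoped ComplexConjugate

variable {V : Type*} [AddCommGroup V] [Module ℂ V] {M : Module.End ℂ V} {h : V →ₗ⋆[ℂ] V →ₗ[ℂ] ℂ}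
  {ι : Type*} {d : ι → ℕ} {ω : ι → ℂ} {σ : Equiv.Perm ι} {x : ι → V}

theorem IsSipSystem.chainVec_ne_zero_iff (H : IsSipSystem M h d ω σ x)
    (p q : (ν : ι) × Fin (d ν)) :
    h (chainVec M d ω x p) (chainVec M d ω x q) ≠ 0 ↔ q = mirror σ H.dim_perm p := by
  rw [eq_mirror_iff, chainVec, chainVec, H.gram _ _ _ _ p.2.2 q.2.2, add_comm (p.2 : ℕ)]

/-- Pairing a linear relation with the partner of each vector isolates each coefficient. -/
theorem IsSipSystem.linearIndependent (H : IsSipSystem M h d ω σ x) :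
    LinearIndependent ℂ (chainVec M d ω x) := by
  rw [linearIndependent_iff']
  intro s g hg p hp
  set r := (mirror σ H.dim_perm).symm p with hr
  have h1 := congrArg (h (chainVec M d ω x r)) hg
  rw [map_sum, map_zero, Finset.sum_eq_single_of_mem p hp] at h1
  · rw [map_smul, smul_eq_mul, mul_eq_zero] at h1
    refine h1.resolve_right ((H.chainVec_ne_zero_iff r p).2 (by rw [hr, Equiv.apply_symm_apply]))
  · intro q _ hq
    rw [map_smul, smul_eq_mul, mul_eq_zero]
    right
    by_contra hne
    apply hq
    rw [(H.chainVec_ne_zero_iff r q).1 hne, hr, Equiv.apply_symm_apply]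

/-- The `h`-orthogonal complement of the span of a system of chains. -/
def chainOrthogonal (M : Module.End ℂ V) (h : V →ₗ⋆[ℂ] V →ₗ[ℂ] ℂ) (ω : ι → ℂ) (x : ι → V) :
    Submodule ℂ V :=
  ⨅ ν, ⨅ a : ℕ, LinearMap.ker (h (((M - ω ν • 1) ^ a) (x ν)))

theorem mem_chainOrthogonal {v : V} :
    v ∈ chainOrthogonal M h ω x ↔ ∀ ν (a : ℕ), h (((M - ω ν • 1) ^ a) (x ν)) v = 0 := by
  simp [chainOrthogonal, Submodule.mem_iInf]

theorem map_mem_chainOrthogonal (hM : ∀ x y, h (M x) y = h x (M y)) {v : V}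
    (hv : v ∈ chainOrthogonal M h ω x) : M v ∈ chainOrthogonal M h ω x := by
  rw [mem_chainOrthogonal] at hv ⊢
  intro ν a
  have h1 : M (((M - ω ν • 1) ^ a) (x ν)) =
      ((M - ω ν • 1) ^ (a + 1)) (x ν) + ω ν • ((M - ω ν • 1) ^ a) (x ν) := by
    rw [pow_succ', Module.End.mul_apply]
    simp
  rw [← hM, h1]
  simp [hv]

theorem IsSipSystem.mem_chainOrthogonal_iff (H : IsSipSystem M h d ω σ x) {v : V} :
    v ∈ chainOrthogonal M h ω x ↔ ∀ p, h (chainVec M d ω x p) v = 0 := by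
  rw [mem_chainOrthogonal]
  refine ⟨fun hv p => hv _ _, fun hv ν a => ?_⟩
  rcases lt_or_ge a (d ν) with ha | ha
  · exact hv ⟨ν, ⟨a, ha⟩⟩
  · rw [pow_apply_eq_zero_of_le (H.pow_apply ν) ha]
    simp

/-- The span of a sip system and its orthogonal complement together span the space. -/
theorem IsSipSystem.exists_add [Finite ι] (H : IsSipSystem M h d ω σ x) (v : V) :
    ∃ w ∈ Submodule.span ℂ (Set.range (chainVec M d ω x)), ∃ u ∈ chainOrthogonal M h ω x,
      v = w + u := by
  cases nonempty_fintype ι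
  set e := chainVec M d ω x with he
  set τ := mirror σ H.dim_perm with hτ
  set w := ∑ q, (h (e (τ.symm q)) v / h (e (τ.symm q)) (e q)) • e q with hw
  refine ⟨w, ?_, v - w, ?_, by abel⟩
  · exact Submodule.sum_mem _ fun q _ =>
      Submodule.smul_mem _ _ (Submodule.subset_span (Set.mem_range_self q))
  · rw [H.mem_chainOrthogonal_iff]
    intro p
    have hne : h (e p) (e (τ p)) ≠ 0 := (H.chainVec_ne_zero_iff p (τ p)).2 rfl
    rw [map_sub, hw, map_sum, Finset.sum_eq_single (τ p)]
    · rw [map_smul, smul_eq_mul, Equiv.symm_apply_apply, div_mul_cancel₀ _ hne, sub_self]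
    · intro q _ hq
      rw [map_smul, smul_eq_mul, mul_eq_zero]
      right
      by_contra hne
      exact hq ((H.chainVec_ne_zero_iff p q).1 hne)
    · simp

theorem IsSipSystem.orthogonal_span (H : IsSipSystem M h d ω σ x)
    (hsymm : ∀ x y, conj (h x y) = h y x) {w u : V}
    (hw : w ∈ Submodule.span ℂ (Set.range (chainVec M d ω x)))
    (hu : u ∈ chainOrthogonal M h ω x) : h u w = 0 := by
  have : Submodule.span ℂ (Set.range (chainVec M d ω x)) ≤ LinearMap.ker (h u) := by
    rw [Submodule.span_le]
    rintro _ ⟨p, rfl⟩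
    rw [SetLike.mem_coe, LinearMap.mem_ker, ← hsymm, H.mem_chainOrthogonal_iff.1 hu p, map_zero]
  exact this hw

theorem coe_restrict_sub_smul_pow {S : Submodule ℂ V} (hS : ∀ v ∈ S, M v ∈ S) (μ : ℂ) (k : ℕ)
    (z : S) : (((M.restrict hS - μ • 1) ^ k) z : V) = ((M - μ • 1) ^ k) z := by
  induction k with
  | zero => simp
  | succ k ih =>
    rw [pow_succ', pow_succ', Module.End.mul_apply, Module.End.mul_apply, ← ih]
    simp

/-- A sip system is extended by a sip system of the orthogonal complement. -/
theorem IsSipSystem.sum (H : IsSipSystem M h d ω σ x) (hsymm : ∀ x y, conj (h x y) = h y x)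
    {S : Submodule ℂ V} (hS : ∀ v ∈ S, M v ∈ S) (hSo : S = chainOrthogonal M h ω x)
    {κ : Type*} {d' : κ → ℕ} {ω' : κ → ℂ} {σ' : Equiv.Perm κ} {y : κ → S}
    (H' : IsSipSystem (M.restrict hS) (h.domRestrict₁₂ S S) d' ω' σ' y) :
    IsSipSystem M h (Sum.elim d d') (Sum.elim ω ω') (Equiv.sumCongr σ σ')
      (Sum.elim x fun κ => (y κ : V)) := by
  have hmem : ∀ (k : κ) (μ : ℂ) (b : ℕ),
      ((M - μ • 1) ^ b) (y k : V) ∈ chainOrthogonal M h ω x := by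
    intro k μ b
    rw [← coe_restrict_sub_smul_pow hS, ← hSo]
    exact Subtype.prop _
  refine ⟨?_, ?_, ?_, ?_, ?_⟩
  · rintro (ν | ν)
    exacts [H.dim_pos ν, H'.dim_pos ν]
  · rintro (ν | ν)
    · exact H.pow_apply ν
    · have := congrArg (Subtype.val) (H'.pow_apply ν)
      rwa [coe_restrict_sub_smul_pow] at this
  · rintro (ν | ν) (ν' | ν') a b ha hb
    · simpa using H.gram ν ν' a b ha hb
    · refine iff_of_false (not_not.2 ?_) (by simp)
      exact mem_chainOrthogonal.1 (hmem ν' _ b) ν a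
    · refine iff_of_false (not_not.2 ?_) (by simp)
      rw [← hsymm, map_eq_zero]
      exact mem_chainOrthogonal.1 (hmem ν _ a) ν' b
    · have := H'.gram ν ν' a b ha hb
      rw [LinearMap.domRestrict₁₂_apply, coe_restrict_sub_smul_pow,
        coe_restrict_sub_smul_pow] at this
      simpa using this
  · rintro (ν | ν)
    exacts [H.dim_perm ν, H'.dim_perm ν]
  · rintro (ν | ν)
    exacts [H.eigenvalue_perm ν, H'.eigenvalue_perm ν]

end Splitting

open scoped ComplexConjugate in
/-- The canonical form of an operator that is selfadjoint for a nondegenerate Hermitian form. Blocks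
in sip form are split off one after the other; the form stays nondegenerate on the orthogonal
complement. -/
theorem exists_isSipSystem_span_eq_top {V : Type*} [AddCommGroup V] [Module ℂ V]
    [FiniteDimensional ℂ V] (M : Module.End ℂ V) (h : V →ₗ⋆[ℂ] V →ₗ[ℂ] ℂ)
    (hsymm : ∀ x y, conj (h x y) = h y x) (hnd : ∀ x, (∀ y, h x y = 0) → x = 0)
    (hM : ∀ x y, h (M x) y = h x (M y)) :
    ∃ (ι : Type) (_ : Finite ι) (d : ι → ℕ) (ω : ι → ℂ) (σ : Equiv.Perm ι) (x : ι → V),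
      IsSipSystem M h d ω σ x ∧ Submodule.span ℂ (Set.range (chainVec M d ω x)) = ⊤ := by
  induction hn : Module.finrank ℂ V using Nat.strong_induction_on generalizing V with
  | _ n ih =>
  rcases subsingleton_or_nontrivial V with hV | hV
  · exact ⟨Empty, inferInstance, Empty.elim, Empty.elim, 1, Empty.elim,
      ⟨Empty.rec, Empty.rec, Empty.rec, Empty.rec, Empty.rec⟩, Subsingleton.elim _ _⟩
  obtain ⟨ι, hι, hne, d, ω, σ, x, H⟩ := exists_isSipSystem_of_nontrivial hsymm hnd hM
  set S := chainOrthogonal M h ω x with hS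
  have hSM : ∀ v ∈ S, M v ∈ S := fun v hv => map_mem_chainOrthogonal hM hv
  have hlt : Module.finrank ℂ S < n := by
    rw [← hn]
    refine Submodule.finrank_lt fun htop => ?_
    obtain ⟨ν⟩ := hne
    set p : (ν : ι) × Fin (d ν) := ⟨ν, ⟨0, H.dim_pos ν⟩⟩
    refine (H.chainVec_ne_zero_iff p _).2 rfl (H.mem_chainOrthogonal_iff.1 ?_ p)
    rw [← hS, htop]
    trivial
  obtain ⟨κ, hκ, d', ω', σ', y, H', hspan⟩ := ih _ hlt (M.restrict hSM) (h.domRestrict₁₂ S S)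
    (fun u v => hsymm u v) (fun u hu => Subtype.ext (hnd u fun v => by
      obtain ⟨w, hw, u', hu', rfl⟩ := H.exists_add v
      rw [map_add, H.orthogonal_span hsymm hw u.2, zero_add]
      exact hu ⟨u', hu'⟩)) (fun u v => hM u v) rfl
  refine ⟨ι ⊕ κ, inferInstance, _, _, _, _, H.sum hsymm hSM hS H', ?_⟩
  rw [eq_top_iff]
  rintro v -
  obtain ⟨w, hw, u, hu, rfl⟩ := H.exists_add v
  refine Submodule.add_mem _ ?_ ?_
  · refine Submodule.span_mono ?_ hw
    rintro _ ⟨p, rfl⟩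
    exact ⟨⟨Sum.inl p.1, p.2⟩, rfl⟩
  · have h1 : (⟨u, hu⟩ : S) ∈ Submodule.span ℂ (Set.range (chainVec (M.restrict hSM) d' ω' y)) := by
      rw [hspan]
      trivial
    have h2 := Submodule.mem_map_of_mem (f := S.subtype) h1
    rw [Submodule.map_span] at h2
    refine Submodule.span_mono ?_ h2
    rintro _ ⟨_, ⟨p, rfl⟩, rfl⟩
    exact ⟨⟨Sum.inr p.1, p.2⟩, (coe_restrict_sub_smul_pow hSM _ _ _).symm⟩

/-! ### Uniqueness of the Jordan block data -/

section JordanUniqueness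

variable {m ι : Type*} {d : ι → ℕ} {ω : ι → ℂ} {c : ι → ℕ → ℂ}
  {ξ : Module.Basis ((ν : ι) × Fin (d ν)) ℂ (m → ℂ)}

/-- The coordinate functional of a basis vector in position `k` of block `ν`, which is set to `0`
beyond the end of the block. -/
noncomputable def blockCoord (ξ : Module.Basis ((ν : ι) × Fin (d ν)) ℂ (m → ℂ)) (ν : ι) (k : ℕ) :
    (m → ℂ) →ₗ[ℂ] ℂ :=
  if h : k < d ν then ξ.coord ⟨ν, ⟨k, h⟩⟩ else 0

theorem blockCoord_of_le {ν : ι} {k : ℕ} (h : d ν ≤ k) (v : m → ℂ) : blockCoord ξ ν k v = 0 := by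
  rw [blockCoord, dif_neg (by omega), LinearMap.zero_apply]

theorem blockCoord_self {ν : ι} {k : ℕ} (h : k < d ν) : blockCoord ξ ν k (ξ ⟨ν, ⟨k, h⟩⟩) = 1 := by
  simp [blockCoord, h]

theorem blockCoord_of_ne {ν ν' : ι} {k k' : ℕ} (h' : k' < d ν') (hne : ¬ (ν = ν' ∧ k = k')) :
    blockCoord ξ ν k (ξ ⟨ν', ⟨k', h'⟩⟩) = 0 := by
  unfold blockCoord
  split_ifs with h
  · rw [Module.Basis.coord_apply, Module.Basis.repr_self, Finsupp.single_eq_of_ne']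
    rintro h2
    obtain ⟨rfl, h3⟩ := Sigma.mk.inj_iff.1 h2
    exact hne ⟨rfl, (congrArg Fin.val (eq_of_heq h3)).symm⟩
  · rfl

variable [Fintype m] {M : Matrix m m ℂ}

theorem IsJordanBasis.sub_smul_eigenvector (H : IsJordanBasis M d ω c ξ) (μ : ℂ) (ν : ι)
    (h : 0 < d ν) :
    (M.mulVecLin - μ • 1) (ξ ⟨ν, ⟨0, h⟩⟩) = (ω ν - μ) • ξ ⟨ν, ⟨0, h⟩⟩ := by
  simp [H.eigenvector ν h, sub_smul]

theorem IsJordanBasis.sub_smul_chain (H : IsJordanBasis M d ω c ξ) (μ : ℂ) (ν : ι) (k : ℕ)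
    (h : k + 1 < d ν) :
    (M.mulVecLin - μ • 1) (ξ ⟨ν, ⟨k + 1, h⟩⟩) = (ω ν - μ) • ξ ⟨ν, ⟨k + 1, h⟩⟩ +
      (Complex.I * c ν k) • ξ ⟨ν, ⟨k, (Nat.lt_succ_self k).trans h⟩⟩ := by
  simp only [LinearMap.sub_apply, Matrix.mulVecLin_apply, H.chain ν k h, LinearMap.smul_apply,
    Module.End.one_apply, sub_smul]
  abel

theorem IsJordanBasis.blockCoord_sub_smul (H : IsJordanBasis M d ω c ξ) (μ : ℂ) (ν : ι) (k : ℕ)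
    (v : m → ℂ) :
    blockCoord ξ ν k ((M.mulVecLin - μ • 1) v) =
      (ω ν - μ) * blockCoord ξ ν k v + Complex.I * c ν k * blockCoord ξ ν (k + 1) v := by
  rcases lt_or_ge k (d ν) with hk | hk
  swap
  · rw [blockCoord_of_le hk, blockCoord_of_le hk, blockCoord_of_le (by omega)]
    ring
  suffices blockCoord ξ ν k ∘ₗ (M.mulVecLin - μ • 1) =
      (ω ν - μ) • blockCoord ξ ν k + (Complex.I * c ν k) • blockCoord ξ ν (k + 1) from
    LinearMap.congr_fun this v
  refine ξ.ext ?_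
  rintro ⟨ν', ⟨_ | k', h'⟩⟩
  · rw [LinearMap.comp_apply, H.sub_smul_eigenvector]
    simp only [map_smul, LinearMap.add_apply, LinearMap.smul_apply, smul_eq_mul]
    rw [blockCoord_of_ne (k := k + 1) h' (by omega)]
    by_cases he : ν = ν' ∧ k = 0
    · obtain ⟨rfl, rfl⟩ := he
      ring
    · rw [blockCoord_of_ne h' he]
      ring
  · rw [LinearMap.comp_apply, H.sub_smul_chain]
    simp only [map_smul, map_add, LinearMap.add_apply, LinearMap.smul_apply, smul_eq_mul]
    by_cases hν : ν = ν'
    · subst hν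
      by_cases hk1 : k = k'
      · subst hk1
        rw [blockCoord_self, blockCoord_self, blockCoord_of_ne _ (by omega)]
      · rw [blockCoord_of_ne (k := k) (k' := k') _ (by omega),
          blockCoord_of_ne (k := k + 1) _ (by omega)]
        by_cases hk2 : k = k' + 1
        · subst hk2
          ring
        · rw [blockCoord_of_ne _ (by omega)]
          ring
    · rw [blockCoord_of_ne _ (by tauto), blockCoord_of_ne _ (by tauto),
        blockCoord_of_ne _ (by tauto)]
      ring

theorem IsJordanBasis.blockCoord_eq_zero_of_mem_ker (H : IsJordanBasis M d ω c ξ) {μ : ℂ}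
    {v : m → ℂ} (hv : (M.mulVecLin - μ • 1) v = 0) {ν : ι} {k : ℕ} (hk : ω ν = μ → k ≠ 0) :
    blockCoord ξ ν k v = 0 := by
  have hrec : ∀ k, (ω ν - μ) * blockCoord ξ ν k v +
      Complex.I * c ν k * blockCoord ξ ν (k + 1) v = 0 := fun k => by
    rw [← H.blockCoord_sub_smul, hv, map_zero]
  by_cases hω : ω ν = μ
  · obtain ⟨j, rfl⟩ := Nat.exists_eq_succ_of_ne_zero (hk hω)
    rcases lt_or_ge (j + 1) (d ν) with hj | hj
    · have := hrec j
      rw [hω, sub_self, zero_mul, zero_add, mul_eq_zero] at this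
      exact this.resolve_left (mul_ne_zero Complex.I_ne_zero (H.const_ne_zero ν j hj))
    · exact blockCoord_of_le hj v
  · rcases le_total (d ν) k with hle | hle
    · exact blockCoord_of_le hle v
    · refine Nat.decreasingInduction (motive := fun k _ => blockCoord ξ ν k v = 0)
        (fun j _ ih => ?_) (blockCoord_of_le le_rfl v) hle
      have := hrec j
      rw [ih, mul_zero, add_zero, mul_eq_zero] at this
      exact this.resolve_left (sub_ne_zero.2 hω)

theorem IsJordanBasis.blockCoord_pow_eq_zero (H : IsJordanBasis M d ω c ξ) {ν : ι} {j k : ℕ}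
    (hjk : d ν ≤ j + k) (w : m → ℂ) :
    blockCoord ξ ν j (((M.mulVecLin - ω ν • 1) ^ k) w) = 0 := by
  induction k generalizing j with
  | zero => exact blockCoord_of_le (by omega) _
  | succ k ih =>
    rw [pow_succ', Module.End.mul_apply, H.blockCoord_sub_smul, ih (j := j + 1) (by omega)]
    ring

theorem IsJordanBasis.mem_range_pow (H : IsJordanBasis M d ω c ξ) {ν : ι} {j k : ℕ}
    (hjk : j + k < d ν) :
    ξ ⟨ν, ⟨j, by omega⟩⟩ ∈ LinearMap.range ((M.mulVecLin - ω ν • 1) ^ k) := by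
  induction k generalizing j with
  | zero => exact ⟨_, rfl⟩
  | succ k ih =>
    obtain ⟨w, hw⟩ := ih (j := j + 1) (by omega)
    have h1 := H.sub_smul_chain (ω ν) ν j (by omega)
    rw [sub_self, zero_smul, zero_add] at h1
    refine ⟨(Complex.I * c ν j)⁻¹ • w, ?_⟩
    rw [pow_succ', Module.End.mul_apply, map_smul, map_smul, hw, h1, smul_smul, inv_mul_cancel₀
      (mul_ne_zero Complex.I_ne_zero (H.const_ne_zero ν j (by omega))), one_smul]

theorem IsJordanBasis.finite (H : IsJordanBasis M d ω c ξ) : Finite ι := by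
  have : Finite ((ν : ι) × Fin (d ν)) := Module.Finite.finite_basis ξ
  exact Finite.of_injective (fun ν => (⟨ν, ⟨0, H.dim_pos ν⟩⟩ : (ν : ι) × Fin (d ν)))
    fun a b hab => congrArg Sigma.fst hab

/-- The number of blocks with eigenvalue `μ` and dimension greater than `k` does not depend on the
Jordan basis: the first vectors of these blocks form a basis of the subspace on the right. -/
theorem IsJordanBasis.card_blocks (H : IsJordanBasis M d ω c ξ) (μ : ℂ) (k : ℕ) :
    Nat.card {ν // ω ν = μ ∧ k < d ν} =
      Module.finrank ℂ ↥(LinearMap.ker (M.mulVecLin - μ • 1) ⊓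
        LinearMap.range ((M.mulVecLin - μ • (1 : Module.End ℂ (m → ℂ))) ^ k)) := by
  have := H.finite
  cases nonempty_fintype ι
  cases nonempty_fintype {ν // ω ν = μ ∧ k < d ν}
  set f : {ν // ω ν = μ ∧ k < d ν} → (m → ℂ) := fun ν => ξ ⟨ν, ⟨0, H.dim_pos ν⟩⟩ with hf
  have hli : LinearIndependent ℂ f := ξ.linearIndependent.comp
    (fun ν : {ν // ω ν = μ ∧ k < d ν} => (⟨ν, ⟨0, H.dim_pos ν⟩⟩ : (ν : ι) × Fin (d ν)))
    fun a b hab => Subtype.ext (congrArg Sigma.fst hab)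
  rw [Nat.card_eq_fintype_card, ← finrank_span_eq_card hli]
  suffices heq : Submodule.span ℂ (Set.range f) = LinearMap.ker (M.mulVecLin - μ • 1) ⊓
      LinearMap.range ((M.mulVecLin - μ • (1 : Module.End ℂ (m → ℂ))) ^ k) by rw [heq]
  apply le_antisymm
  · rw [Submodule.span_le]
    rintro _ ⟨⟨ν, rfl, hk⟩, rfl⟩
    refine ⟨?_, H.mem_range_pow (by omega)⟩
    rw [SetLike.mem_coe, LinearMap.mem_ker, hf, H.sub_smul_eigenvector, sub_self, zero_smul]
  · rintro v ⟨hker, w, rfl⟩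
    rw [← ξ.sum_repr (((M.mulVecLin - μ • (1 : Module.End ℂ (m → ℂ))) ^ k) w)]
    refine Submodule.sum_mem _ ?_
    rintro ⟨ν, ⟨j, hj⟩⟩ -
    have hcoord : ∀ v, ξ.repr v ⟨ν, ⟨j, hj⟩⟩ = blockCoord ξ ν j v := fun v => by
      simp [blockCoord, hj]
    rw [hcoord]
    by_cases hj0 : ω ν = μ → j ≠ 0
    · rw [H.blockCoord_eq_zero_of_mem_ker hker hj0, zero_smul]
      exact Submodule.zero_mem _
    · push Not at hj0
      obtain ⟨rfl, rfl⟩ := hj0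
      rcases lt_or_ge k (d ν) with hk | hk
      · exact Submodule.smul_mem _ _ (Submodule.subset_span ⟨⟨ν, rfl, hk⟩, rfl⟩)
      · rw [H.blockCoord_pow_eq_zero (by omega), zero_smul]
        exact Submodule.zero_mem _

theorem IsJordanBasis.card_blocks_eq (H : IsJordanBasis M d ω c ξ) (μ : ℂ) (k : ℕ) :
    Nat.card {ν // ω ν = μ ∧ k < d ν} =
      Nat.card {ν // ω ν = μ ∧ k + 1 < d ν} + Nat.card {ν // (ω ν, d ν) = (μ, k + 1)} := by
  have := H.finite
  rw [← Nat.card_sum]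
  classical
  refine Nat.card_congr ((Equiv.subtypeEquivRight fun ν => ?_).trans
    (subtypeOrEquiv _ _ ?_))
  · rw [Prod.mk.injEq]
    constructor
    · rintro ⟨h1, h2⟩
      rcases eq_or_lt_of_le (Nat.succ_le_of_lt h2) with h3 | h3
      exacts [Or.inr ⟨h1, h3.symm⟩, Or.inl ⟨h1, h3⟩]
    · rintro (⟨h1, h2⟩ | ⟨h1, h2⟩) <;> exact ⟨h1, by omega⟩
  · rw [Pi.disjoint_iff]
    intro ν
    rw [Prop.disjoint_iff, Prod.mk.injEq]
    rintro ⟨⟨-, h1⟩, -, h2⟩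
    omega

/-- Uniqueness of the Jordan form: two Jordan bases of a matrix have the same dimensions and
eigenvalues of blocks, up to a relabelling of the blocks. -/
theorem IsJordanBasis.exists_equiv (H : IsJordanBasis M d ω c ξ) {κ : Type*} {d' : κ → ℕ}
    {ω' : κ → ℂ} {c' : κ → ℕ → ℂ} {ξ' : Module.Basis ((ν : κ) × Fin (d' ν)) ℂ (m → ℂ)}
    (H' : IsJordanBasis M d' ω' c' ξ') :
    ∃ e : ι ≃ κ, (∀ ν, d' (e ν) = d ν) ∧ ∀ ν, ω' (e ν) = ω ν := by
  have := H.finite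
  have := H'.finite
  have hcard : ∀ p : ℂ × ℕ,
      Nat.card {ν // (ω ν, d ν) = p} = Nat.card {ν // (ω' ν, d' ν) = p} := by
    rintro ⟨μ, _ | k⟩
    · have h1 : IsEmpty {ν // (ω ν, d ν) = (μ, 0)} :=
        ⟨fun ν => (H.dim_pos ν).ne' (congrArg Prod.snd ν.2)⟩
      have h2 : IsEmpty {ν // (ω' ν, d' ν) = (μ, 0)} :=
        ⟨fun ν => (H'.dim_pos ν).ne' (congrArg Prod.snd ν.2)⟩
      rw [Nat.card_of_isEmpty, Nat.card_of_isEmpty]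
    · have h1 := H.card_blocks_eq μ k
      have h2 := H'.card_blocks_eq μ k
      rw [H.card_blocks, H.card_blocks] at h1
      rw [H'.card_blocks, H'.card_blocks] at h2
      omega
  have hmap := fun p => (Finite.card_eq.1 (hcard p)).some
  exact ⟨Equiv.ofFiberEquiv hmap, fun ν => congrArg Prod.snd (Equiv.ofFiberEquiv_map hmap ν),
    fun ν => congrArg Prod.fst (Equiv.ofFiberEquiv_map hmap ν)⟩

end JordanUniqueness

/-! ### Jordan bases of `N S` and `S N` -/

section Assembly

open scoped ComplexConjugate

theorem IsSipSystem.reindex {V : Type*} [AddCommGroup V] [Module ℂ V] {M : Module.End ℂ V}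
    {h : V →ₗ⋆[ℂ] V →ₗ[ℂ] ℂ} {ι κ : Type*} {d : ι → ℕ} {ω : ι → ℂ} {σ : Equiv.Perm ι} {x : ι → V}
    (H : IsSipSystem M h d ω σ x) (e : κ ≃ ι) :
    IsSipSystem M h (d ∘ e) (ω ∘ e) ((e.trans σ).trans e.symm) (x ∘ e) where
  dim_pos ν := H.dim_pos _
  pow_apply ν := H.pow_apply _
  gram ν ν' a b ha hb := by
    simpa [Equiv.eq_symm_apply] using H.gram (e ν) (e ν') a b ha hb
  dim_perm ν := by simp [H.dim_perm]
  eigenvalue_perm ν := by simp [H.eigenvalue_perm]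

theorem range_chainVec_reindex {V : Type*} [AddCommGroup V] [Module ℂ V] (M : Module.End ℂ V)
    {ι κ : Type*} (d : ι → ℕ) (ω : ι → ℂ) (x : ι → V) (e : κ ≃ ι) :
    Set.range (chainVec M (d ∘ e) (ω ∘ e) (x ∘ e)) = Set.range (chainVec M d ω x) := by
  ext v
  constructor
  · rintro ⟨p, rfl⟩
    exact ⟨⟨e p.1, p.2⟩, rfl⟩
  · rintro ⟨⟨ν, k⟩, rfl⟩
    obtain ⟨ν, rfl⟩ := e.surjective ν
    exact ⟨⟨ν, k⟩, rfl⟩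

/-- A spanning sip system gives a Jordan basis with arbitrary prescribed chain constants: the chain
is listed from the bottom and its vectors are rescaled, which does not affect the vanishing of
overlaps. -/
theorem IsSipSystem.exists_isJordanBasis {m ι : Type*} [Fintype m] {M : Matrix m m ℂ}
    {h : (m → ℂ) →ₗ⋆[ℂ] (m → ℂ) →ₗ[ℂ] ℂ} {d : ι → ℕ} {ω : ι → ℂ} {σ : Equiv.Perm ι}
    {x : ι → m → ℂ} (H : IsSipSystem M.mulVecLin h d ω σ x)
    (hspan : Submodule.span ℂ (Set.range (chainVec M.mulVecLin d ω x)) = ⊤)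
    {c : ι → ℕ → ℂ} (hc : ∀ ν k, k + 1 < d ν → c ν k ≠ 0) :
    ∃ ξ : Module.Basis ((ν : ι) × Fin (d ν)) ℂ (m → ℂ), IsJordanBasis M d ω c ξ ∧
      ∀ p q, h (ξ p) (ξ q) ≠ 0 ↔ q = mirror σ H.dim_perm p := by
  set γ : (ν : ι) × Fin (d ν) → ℂ := fun p => ∏ j ∈ Finset.range p.2, Complex.I * c p.1 j with hγ
  have hγ0 : ∀ p, γ p ≠ 0 := fun p => Finset.prod_ne_zero_iff.2 fun j hj =>
    mul_ne_zero Complex.I_ne_zero (hc _ _ (by have := Finset.mem_range.1 hj; omega))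
  set ξ := ((Module.Basis.mk H.linearIndependent hspan.ge).reindex
    (Equiv.sigmaCongrRight fun ν : ι => (Fin.revPerm : Equiv.Perm (Fin (d ν))))).isUnitSMul
    (fun p => (hγ0 p).isUnit) with hξdef
  have hξ : ∀ ν k, ∀ hk : k < d ν, ξ ⟨ν, ⟨k, hk⟩⟩ =
      γ ⟨ν, ⟨k, hk⟩⟩ • ((M.mulVecLin - ω ν • 1) ^ (d ν - 1 - k)) (x ν) := by
    intro ν k hk
    rw [hξdef, Module.Basis.isUnitSMul_apply, Module.Basis.reindex_apply, Module.Basis.mk_apply]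
    congr 1
    change ((M.mulVecLin - ω ν • 1) ^ (d ν - (k + 1))) (x ν) = _
    rw [Nat.sub_sub, add_comm 1 k]
  have hM : ∀ (μ : ℂ) (v : m → ℂ), M *ᵥ v = μ • v + (M.mulVecLin - μ • 1) v := by
    intro μ v
    simp
  refine ⟨ξ, ⟨H.dim_pos, hc, fun ν h0 => ?_, fun ν k hk => ?_⟩, ?_⟩
  · rw [hM (ω ν), hξ, map_smul, ← Module.End.mul_apply, ← pow_succ',
      show d ν - 1 - 0 + 1 = d ν by omega, H.pow_apply, smul_zero, add_zero]
  · rw [hM (ω ν)]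
    congr 1
    rw [hξ, hξ, map_smul, ← Module.End.mul_apply, ← pow_succ',
      show d ν - 1 - (k + 1) + 1 = d ν - 1 - k by omega, smul_smul]
    congr 1
    simp only [hγ]
    rw [Finset.prod_range_succ, mul_comm]
  · rintro ⟨ν, k, hk⟩ ⟨ν', l, hl⟩
    rw [eq_mirror_iff, hξ, hξ]
    simp only [map_smul, map_smulₛₗ, LinearMap.smul_apply, smul_eq_mul]
    rw [mul_ne_zero_iff, mul_ne_zero_iff, H.gram ν ν' _ _ (by omega) (by omega)]
    have h1 : conj (γ ⟨ν, ⟨k, hk⟩⟩) ≠ 0 := (map_ne_zero _).2 (hγ0 _)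
    simp only [ne_eq, hγ0, h1, not_false_eq_true, true_and]
    refine and_congr_right fun hν => ?_
    have := H.dim_perm ν
    rw [← hν] at this
    omega

variable {n : Type*} [Fintype n] [DecidableEq n]

theorem metric_mul_self : metric n * metric n = 1 := by
  simp [metric, Matrix.fromBlocks_multiply]

theorem metric_conjTranspose {n : Type*} [DecidableEq n] : (metric n)ᴴ = metric n := by
  simp [metric, Matrix.fromBlocks_conjTranspose]

theorem stab_conjTranspose {n : Type*} {A B : Matrix n n ℂ} (hA : A.IsHermitian) (hB : B.IsSymm) :
    (stab A B)ᴴ = stab A B := by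
  rw [stab, Matrix.fromBlocks_conjTranspose]
  congr 1
  · ext i j
    simpa using hB.apply i j
  · ext i j
    simpa using congrArg star (hB.apply i j)
  · ext i j
    simpa using (hA.apply j i).symm

/-- The indefinite Hermitian form `x† N y` on the phase space. -/
def metricForm (n : Type*) [Fintype n] [DecidableEq n] :
    (n ⊕ n → ℂ) →ₗ⋆[ℂ] (n ⊕ n → ℂ) →ₗ[ℂ] ℂ :=
  LinearMap.mk₂'ₛₗ (starRingEnd ℂ) (RingHom.id ℂ) (fun x y => overlap x (metric n *ᵥ y))
    (fun x y z => by simp [overlap, add_dotProduct])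
    (fun a x y => by simp [overlap, smul_dotProduct])
    (fun x y z => by simp [overlap, Matrix.mulVec_add, dotProduct_add])
    (fun a x y => by simp [overlap, Matrix.mulVec_smul, dotProduct_smul])

theorem metricForm_apply (x y : n ⊕ n → ℂ) : metricForm n x y = overlap x (metric n *ᵥ y) := rfl

theorem star_metricForm (x y : n ⊕ n → ℂ) : conj (metricForm n x y) = metricForm n y x := by
  rw [metricForm_apply, metricForm_apply, overlap, overlap, starRingEnd_apply,
    Matrix.star_dotProduct, star_star, Matrix.star_mulVec, metric_conjTranspose,
    ← Matrix.dotProduct_mulVec]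

open scoped ComplexOrder in
theorem eq_zero_of_metricForm {x : n ⊕ n → ℂ} (hx : ∀ y, metricForm n x y = 0) : x = 0 := by
  have h1 := hx (metric n *ᵥ x)
  rw [metricForm_apply, overlap, Matrix.mulVec_mulVec, metric_mul_self, Matrix.one_mulVec] at h1
  exact dotProduct_star_self_eq_zero.1 h1

theorem metricForm_adjoint {A B : Matrix n n ℂ} (hA : A.IsHermitian) (hB : B.IsSymm)
    (x y : n ⊕ n → ℂ) :
    metricForm n ((metric n * stab A B).mulVecLin x) y =
      metricForm n x ((metric n * stab A B).mulVecLin y) := by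
  rw [metricForm_apply, metricForm_apply, overlap, overlap, Matrix.mulVecLin_apply,
    Matrix.mulVecLin_apply, Matrix.star_mulVec, ← Matrix.dotProduct_mulVec, Matrix.mulVec_mulVec,
    Matrix.mulVec_mulVec, Matrix.conjTranspose_mul, stab_conjTranspose hA hB, metric_conjTranspose,
    Matrix.mul_assoc, metric_mul_self, ← Matrix.mul_assoc, metric_mul_self, Matrix.mul_one,
    Matrix.one_mul]

/-- Multiplication by the metric carries Jordan bases of `N S` to Jordan bases of `S N`. -/
theorem IsJordanBasis.metric_mulVec {S : Matrix (n ⊕ n) (n ⊕ n) ℂ} {ι : Type*} {d : ι → ℕ}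
    {ω : ι → ℂ} {c : ι → ℕ → ℂ} {ξ : Module.Basis ((ν : ι) × Fin (d ν)) ℂ (n ⊕ n → ℂ)}
    (H : IsJordanBasis (metric n * S) d ω c ξ) :
    ∃ η : Module.Basis ((ν : ι) × Fin (d ν)) ℂ (n ⊕ n → ℂ),
      IsJordanBasis (S * metric n) d ω c η ∧ ∀ p, η p = metric n *ᵥ ξ p := by
  have hinv : ∀ v : n ⊕ n → ℂ, metric n *ᵥ metric n *ᵥ v = v := fun v => by
    rw [Matrix.mulVec_mulVec, metric_mul_self, Matrix.one_mulVec]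
  set η := ξ.map (LinearEquiv.ofInvolutive (metric n).mulVecLin hinv)
  have hη : ∀ p, η p = metric n *ᵥ ξ p := fun _ => rfl
  have hS : ∀ p, (S * metric n) *ᵥ η p = metric n *ᵥ ((metric n * S) *ᵥ ξ p) := fun p => by
    rw [hη, Matrix.mulVec_mulVec, Matrix.mulVec_mulVec, Matrix.mul_assoc, metric_mul_self,
      ← Matrix.mul_assoc, metric_mul_self, Matrix.mul_one, Matrix.one_mul]
  refine ⟨η, ⟨H.dim_pos, H.const_ne_zero, fun ν h => ?_, fun ν k h => ?_⟩, hη⟩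
  · rw [hS, H.eigenvector, Matrix.mulVec_smul, hη]
  · rw [hS, H.chain, Matrix.mulVec_add, Matrix.mulVec_smul, Matrix.mulVec_smul, hη, hη]

end Assembly

end RPA

theorem mainTheorem4 {n : Type*} [Fintype n] [DecidableEq n]
    (A B : Matrix n n ℂ) (hA : A.IsHermitian) (hB : B.IsSymm) :
    -- a complete set of Jordan basis vectors of `N S` exists
    (∃ (r : ℕ) (d : Fin r → ℕ) (ω : Fin r → ℂ) (c : Fin r → ℕ → ℂ)
      (ξ : Module.Basis ((ν : Fin r) × Fin (d ν)) ℂ (n ⊕ n → ℂ)),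
      RPA.IsJordanBasis (RPA.metric n * RPA.stab A B) d ω c ξ) ∧
    -- every such set can be transformed into one with the one-to-one property
    ∀ {ι : Type*} (d : ι → ℕ) (ω : ι → ℂ) (c : ι → ℕ → ℂ)
      (ξ₀ : Module.Basis ((ν : ι) × Fin (d ν)) ℂ (n ⊕ n → ℂ)),
      RPA.IsJordanBasis (RPA.metric n * RPA.stab A B) d ω c ξ₀ →
      ∃ ξ η : Module.Basis ((ν : ι) × Fin (d ν)) ℂ (n ⊕ n → ℂ),
        RPA.IsJordanBasis (RPA.metric n * RPA.stab A B) d ω c ξ ∧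
        RPA.IsJordanBasis (RPA.stab A B * RPA.metric n) d ω c η ∧
        (∀ p, η p = RPA.metric n *ᵥ ξ p) ∧
        -- correspondence `τ` of basis vectors and `σ` of Jordan blocks
        ∃ (τ : Equiv.Perm ((ν : ι) × Fin (d ν))) (σ : Equiv.Perm ι),
          (∀ p q, RPA.overlap (ξ p) (η q) ≠ 0 ↔ q = τ p) ∧
          (∀ p, (τ p).1 = σ p.1) ∧
          (∀ ν, d (σ ν) = d ν) ∧
          (∀ ν, ω (σ ν) = star (ω ν)) ∧
          (∀ p, ((τ p).2 : ℕ) + (p.2 : ℕ) + 1 = d p.1) := by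
  obtain ⟨κ, hκ, d', ω', σ', x, H, hspan⟩ := RPA.exists_isSipSystem_span_eq_top
    (RPA.metric n * RPA.stab A B).mulVecLin (RPA.metricForm n) RPA.star_metricForm
    (fun x hx => RPA.eq_zero_of_metricForm hx) (RPA.metricForm_adjoint hA hB)
  refine ⟨?_, ?_⟩
  · obtain ⟨r, ⟨e⟩⟩ := Finite.exists_equiv_fin κ
    obtain ⟨ξ, hξ, -⟩ := (H.reindex e.symm).exists_isJordanBasis
      (by rw [RPA.range_chainVec_reindex, hspan]) (c := fun _ _ => 1) (fun _ _ _ => one_ne_zero)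
    exact ⟨r, _, _, _, ξ, hξ⟩
  · intro ι d ω c ξ₀ H₀
    obtain ⟨ξ', hξ', -⟩ := H.exists_isJordanBasis hspan (c := fun _ _ => 1)
      (fun _ _ _ => one_ne_zero)
    obtain ⟨e, hd, hω⟩ := H₀.exists_equiv hξ'
    obtain rfl : d' ∘ e = d := funext hd
    obtain rfl : ω' ∘ e = ω := funext hω
    have He := H.reindex e
    obtain ⟨ξ, hξ, hτ⟩ := He.exists_isJordanBasis
      (by rw [RPA.range_chainVec_reindex, hspan]) H₀.const_ne_zero
    obtain ⟨η, hη, hηξ⟩ := hξ.metric_mulVec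
    refine ⟨ξ, η, hξ, hη, hηξ, RPA.mirror _ He.dim_perm, _, fun p q => ?_, fun p => ?_,
      He.dim_perm, He.eigenvalue_perm, fun p => ?_⟩
    · rw [hηξ, ← RPA.metricForm_apply]
      exact hτ p q
    · exact ((RPA.eq_mirror_iff _ He.dim_perm p _).1 rfl).1
    · exact ((RPA.eq_mirror_iff _ He.dim_perm p _).1 rfl).2
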